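/- For $A\subset\mathbb Z$ let $$d^*(A):=\lim_{L\to\infty}\ \sup_{N\in\mathbb Z}\ \frac{|A\cap[N,N+L]|}{L+1}$$ be the upper Banach density of $A$ (the limit always exists). A set $S\subset\mathbb Z$ is syndetic if $S+F=\mathbb Z$ for some finite $F\subset\mathbb Z$; it is thick if for every $L$ it contains an interval of $L$ consecutive integers; it is piecewise syndetic if it is the intersection of a syndetic set and a thick set. (1) For every integer $k\ge 2$ and every $\varepsilon>0$ there is a set $B\subset\mathbb Z$ with $d^*(B)>1-\varepsilon$ such that $\{n^k+b : n\in\mathbb Z,\ n\ge 0,\ b\in B\}$ is not piecewise syndetic. (2) For every $\varepsilon>0$ there is a set $B\subset\mathbb Z$ with $d^*(B)>1-\varepsilon$ such that $\{p+b : p\text{ prime},\ b\in B\}$ is not piecewise syndetic. -/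

import Mathlib

open scoped Pointwise
open Filter Topology

/-- `sup_N |A ∩ [N, N + L]| / (L + 1)`: the largest relative density of `A` in an interval
of `L + 1` consecutive integers. -/
noncomputable def maxIntervalDensity (A : Set ℤ) (L : ℕ) : ℝ :=
  ⨆ N : ℤ, ((A ∩ Set.Icc N (N + L)).ncard : ℝ) / ((L : ℝ) + 1)

/-- The upper Banach density
`d*(A) = lim_{L → ∞} sup_N |A ∩ [N, N + L]| / (L + 1)` of a set of integers.
The limit always exists, see `tendsto_upperBanachDensity`. -/
noncomputable def upperBanachDensity (A : Set ℤ) : ℝ :=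
  limUnder atTop (maxIntervalDensity A)

/-- `S` is syndetic if `S + F = ℤ` for some finite set `F`. -/
def IsSyndetic (S : Set ℤ) : Prop :=
  ∃ F : Finset ℤ, S + (F : Set ℤ) = Set.univ

/-- `S` is thick if it contains, for every `L`, an interval of `L` consecutive integers. -/
def IsThick (S : Set ℤ) : Prop :=
  ∀ L : ℕ, ∃ N : ℤ, Set.Ico N (N + L) ⊆ S

/-- `S` is piecewise syndetic if it is the intersection of a syndetic set and a thick set. -/
def IsPiecewiseSyndetic (S : Set ℤ) : Prop :=
  ∃ R T : Set ℤ, IsSyndetic R ∧ IsThick T ∧ S = R ∩ T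

theorem ncard_inter_Ico_le (A : Set ℤ) (n : ℕ) (N : ℤ) :
    ((A ∩ Set.Ico N (N + n)).ncard : ℝ) ≤ n := by
  have h1 : (A ∩ Set.Ico N (N + n)).ncard ≤ (Set.Ico N (N + n)).ncard :=
    Set.ncard_le_ncard Set.inter_subset_right (Set.finite_Ico _ _)
  have h2 : (Set.Ico N (N + n)).ncard = n := by
    rw [← Finset.coe_Ico, Set.ncard_coe_finset, Int.card_Ico]; omega
  exact_mod_cast h2 ▸ h1

/-- The limit that defines the upper Banach density exists. -/
theorem tendsto_upperBanachDensity (A : Set ℤ) :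
    Tendsto (maxIntervalDensity A) atTop (𝓝 (upperBanachDensity A)) := by
  let u : ℕ → ℝ := fun n => ⨆ N : ℤ, ((A ∩ Set.Ico N (N + n)).ncard : ℝ)
  have hbdd : ∀ n : ℕ, BddAbove (Set.range fun N : ℤ => ((A ∩ Set.Ico N (N + n)).ncard : ℝ)) := by
    rintro n
    refine ⟨n, ?_⟩
    rintro _ ⟨N, rfl⟩
    exact ncard_inter_Ico_le A n N
  have hsub : Subadditive u := by
    intro m n
    refine ciSup_le fun N => ?_
    have h : A ∩ Set.Ico N (N + ((m + n : ℕ) : ℤ)) ⊆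
        (A ∩ Set.Ico N (N + m)) ∪ (A ∩ Set.Ico (N + m) (N + m + n)) := by
      rintro x ⟨hx, h1, h2⟩
      push_cast at h2
      by_cases h3 : x < N + m
      · exact Or.inl ⟨hx, h1, h3⟩
      · exact Or.inr ⟨hx, not_lt.mp h3, by linarith⟩
    have h1 := Set.ncard_le_ncard h
      (((Set.finite_Ico _ _).inter_of_right _).union ((Set.finite_Ico _ _).inter_of_right _))
    have h2 := h1.trans (Set.ncard_union_le _ _)
    have h3 : ((A ∩ Set.Ico N (N + ((m + n : ℕ) : ℤ))).ncard : ℝ) ≤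
        (A ∩ Set.Ico N (N + m)).ncard + (A ∩ Set.Ico (N + m) (N + m + n)).ncard := by
      exact_mod_cast h2
    exact h3.trans (add_le_add (le_ciSup (hbdd m) N) (le_ciSup (hbdd n) (N + m)))
  have hlim : Tendsto (fun n => u n / n) atTop (𝓝 hsub.lim) := by
    refine hsub.tendsto_lim ⟨0, ?_⟩
    rintro _ ⟨n, rfl⟩
    exact div_nonneg (Real.iSup_nonneg fun N => Nat.cast_nonneg _) (Nat.cast_nonneg _)
  refine tendsto_nhds_limUnder ⟨hsub.lim, ?_⟩
  refine (hlim.comp (tendsto_add_atTop_nat 1)).congr fun L => ?_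
  have hset : ∀ N : ℤ, Set.Ico N (N + ((L + 1 : ℕ) : ℤ)) = Set.Icc N (N + L) := by
    intro N; ext x; simp only [Set.mem_Ico, Set.mem_Icc]; push_cast; omega
  simp only [Function.comp, u, maxIntervalDensity, hset]
  rw [div_eq_mul_inv, Real.iSup_mul_of_nonneg (by positivity)]
  simp [div_eq_mul_inv]

/-!
The two sums are instances of one phenomenon. Call `S ⊆ ℤ` *profinitely null* if for every `δ > 0`
some modulus `q > 0` is such that `S` meets at most `δ q` residue classes modulo `q`. Then for every
`ε > 0` there is `B` with `d*(B) > 1 - ε` and `S + B` not piecewise syndetic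
(`IsProfinitelyNull.exists_not_isPiecewiseSyndetic_add`).

To destroy piecewise syndeticity it suffices that, for every `m`, some full residue class
`X_m = t_m + q_m ℤ` is such that `S + B` misses `[x - m, x + m]` for all `x ∈ X_m`, which means that
`B` misses `E_m = X_m + [-m, m] - S`. The set `E_m` is periodic modulo `q_m`, and as `S` is
profinitely null its density can be made as small as desired. If that density is below `1 / N_m`,
some choice of the shift `t_m` makes `E_m` disjoint from `[0, N_m)`
(`IsProfinitelyNull.exists_sparse_periodic_superset`). Let `B` be the complement of `⋃ E_m`. On
`[0, N_m)` only `E_0, …, E_{m-1}` matter, and if `N_m` is large compared with their periods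
they occupy at most a proportion `ε / 2` of it.

The `k`-th powers (`k ≥ 2`) and the primes are profinitely null for the same reason: for every prime
`p`, the elements divisible by `p` are all congruent modulo `p ^ 2`. Thus at most `p ^ 2 - p + 1`
classes modulo `p ^ 2` are met, and by the Chinese remainder theorem the proportion of classes met
modulo `∏ p ^ 2` is at most `∏ (1 - 1 / p + 1 / p ^ 2)`, which tends to `0` because `∑ 1 / p`
diverges (`isProfinitelyNull_of_modEq_sq`).
-/

/-! ### Profinitely null sets -/

/-- The number of residue classes modulo `q` met by `S` (meaningful for `q > 0`). -/
noncomputable def residueCount (S : Set ℤ) (q : ℕ) : ℕ :=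
  ((Int.cast : ℤ → ZMod q) '' S).ncard

/-- `S` is profinitely null if for every `δ > 0` it meets at most a proportion `δ` of the residue
classes modulo some `q`; equivalently, its closure in the profinite integers is a Haar null set. -/
def IsProfinitelyNull (S : Set ℤ) : Prop :=
  ∀ δ : ℝ, 0 < δ → ∃ q : ℕ, 0 < q ∧ (residueCount S q : ℝ) ≤ δ * q

theorem residueCount_mul_le (S : Set ℤ) {a b : ℕ} (ha : 0 < a) (hb : 0 < b)
    (hab : a.Coprime b) :
    residueCount S (a * b) ≤ residueCount S a * residueCount S b := by
  have : NeZero a := ⟨ha.ne'⟩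
  have : NeZero b := ⟨hb.ne'⟩
  have : NeZero (a * b) := ⟨(Nat.mul_pos ha hb).ne'⟩
  unfold residueCount
  rw [← Set.ncard_prod]
  refine Set.ncard_le_ncard_of_injOn (ZMod.chineseRemainder hab) ?_
    (ZMod.chineseRemainder hab).injective.injOn (Set.toFinite _)
  rintro _ ⟨s, hs, rfl⟩
  rw [map_intCast]
  exact ⟨⟨s, hs, rfl⟩, ⟨s, hs, rfl⟩⟩

/-- The residues modulo `p ^ 2` that are multiples of `p` number `p`, and `S` meets at most one of
them. -/
theorem residueCount_sq_le {S : Set ℤ} {p : ℕ} (hp : 0 < p)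
    (hS : ∀ s ∈ S, ∀ s' ∈ S, (p : ℤ) ∣ s → (p : ℤ) ∣ s' → s ≡ s' [ZMOD (p : ℤ) ^ 2]) :
    residueCount S (p ^ 2) + p ≤ p ^ 2 + 1 := by
  have : NeZero p := ⟨hp.ne'⟩
  have : NeZero (p ^ 2) := ⟨(pow_pos hp 2).ne'⟩
  set R : Set (ZMod (p ^ 2)) := (Int.cast : ℤ → ZMod (p ^ 2)) '' S
  set D : Set (ZMod (p ^ 2)) := (fun i : ℕ => ((p * i : ℕ) : ZMod (p ^ 2))) '' Set.Iio p
  have hD : D.ncard = p := by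
    rw [Set.InjOn.ncard_image]
    · rw [← Finset.coe_Iio, Set.ncard_coe_finset, Nat.card_Iio]
    · intro i hi j hj hij
      simp only [Set.mem_Iio] at hi hj
      have h := (ZMod.natCast_eq_natCast_iff' _ _ _).1 hij
      rw [Nat.mod_eq_of_lt (by nlinarith), Nat.mod_eq_of_lt (by nlinarith)] at h
      exact Nat.eq_of_mul_eq_mul_left hp h
  have hdvd : ∀ s : ℤ, (s : ZMod (p ^ 2)) ∈ D → (p : ℤ) ∣ s := by
    rintro s ⟨i, -, hi⟩
    have h : (((p * i : ℕ) : ℤ) : ZMod (p ^ 2)) = (s : ZMod (p ^ 2)) := by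
      rw [← hi]; push_cast; rfl
    have h2 := (ZMod.intCast_eq_intCast_iff_dvd_sub _ _ _).1 h
    have h3 : (p : ℤ) ∣ s - ((p * i : ℕ) : ℤ) :=
      (Dvd.intro_left ((p : ℤ)) (by push_cast; ring)).trans h2
    have h4 : (p : ℤ) ∣ ((p * i : ℕ) : ℤ) := ⟨i, by push_cast; ring⟩
    exact (dvd_sub_left h4).1 h3
  have hRD : (R ∩ D).ncard ≤ 1 := by
    refine (Set.ncard_le_one (Set.toFinite _)).2 ?_
    rintro _ ⟨⟨s, hs, rfl⟩, hsD⟩ _ ⟨⟨s', hs', rfl⟩, hsD'⟩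
    refine (ZMod.intCast_eq_intCast_iff _ _ _).2 ?_
    have := hS s hs s' hs' (hdvd s hsD) (hdvd s' hsD')
    exact_mod_cast this
  have hU : (R ∪ D).ncard ≤ p ^ 2 := by
    have := Set.ncard_le_card (R ∪ D)
    simpa using this
  have := Set.ncard_union_add_ncard_inter R D
  have hR : residueCount S (p ^ 2) = R.ncard := rfl
  omega

theorem residueCount_prod_sq_le {S : Set ℤ}
    (hS : ∀ p : ℕ, p.Prime → ∀ s ∈ S, ∀ s' ∈ S, (p : ℤ) ∣ s → (p : ℤ) ∣ s' →
      s ≡ s' [ZMOD (p : ℤ) ^ 2]) (P : Finset Nat.Primes) :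
    (residueCount S (∏ p ∈ P, (p : ℕ) ^ 2) : ℝ) ≤
      Real.exp (-(∑ p ∈ P, 1 / ((p : ℕ) : ℝ)) / 2) * ((∏ p ∈ P, (p : ℕ) ^ 2 : ℕ) : ℝ) := by
  classical
  induction P using Finset.induction_on with
  | empty =>
    simp only [Finset.prod_empty, Finset.sum_empty]
    have : residueCount S 1 ≤ 1 := Set.ncard_le_one_of_subsingleton _
    simpa using this
  | insert p P hp ih =>
    rw [Finset.prod_insert hp, Finset.sum_insert hp]
    have hp0 : 0 < (p : ℕ) := p.2.pos
    have hcop : ((p : ℕ) ^ 2).Coprime (∏ p ∈ P, (p : ℕ) ^ 2) := by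
      refine Nat.Coprime.prod_right fun r hr => Nat.Coprime.pow _ _ ?_
      refine (Nat.coprime_primes p.2 r.2).2 fun h => hp ?_
      rwa [Subtype.ext h]
    have h1 := residueCount_mul_le S (pow_pos hp0 2)
      (Finset.prod_pos fun r _ => pow_pos r.2.pos 2) hcop
    have h2 : (residueCount S ((p : ℕ) ^ 2) : ℝ) ≤
        Real.exp (-(1 / ((p : ℕ) : ℝ)) / 2) * ((p : ℕ) : ℝ) ^ 2 := by
      have h3 : (residueCount S ((p : ℕ) ^ 2) : ℝ) + (p : ℕ) ≤ ((p : ℕ) : ℝ) ^ 2 + 1 := by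
        exact_mod_cast residueCount_sq_le hp0 (hS p p.2)
      have h4 := Real.add_one_le_exp (-(1 / ((p : ℕ) : ℝ)) / 2)
      have h5 : (2 : ℝ) ≤ ((p : ℕ) : ℝ) := by exact_mod_cast p.2.two_le
      have h6 : (-(1 / ((p : ℕ) : ℝ)) / 2 + 1) * ((p : ℕ) : ℝ) ^ 2 =
          ((p : ℕ) : ℝ) ^ 2 - ((p : ℕ) : ℝ) / 2 := by
        field_simp
        ring
      have h7 := mul_le_mul_of_nonneg_right h4 (sq_nonneg ((p : ℕ) : ℝ))
      linarith
    calc (residueCount S ((p : ℕ) ^ 2 * ∏ p ∈ P, (p : ℕ) ^ 2) : ℝ)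
        ≤ residueCount S ((p : ℕ) ^ 2) * residueCount S (∏ p ∈ P, (p : ℕ) ^ 2) := by
          exact_mod_cast h1
      _ ≤ _ := mul_le_mul h2 ih (Nat.cast_nonneg _) (by positivity)
      _ = _ := by
          rw [neg_add, add_div, Real.exp_add]
          push_cast
          ring

/-- If the multiples of `p` in `S` are congruent to one another modulo `p ^ 2`, for every prime
`p`, then `S` is profinitely null. -/
theorem isProfinitelyNull_of_modEq_sq {S : Set ℤ}
    (hS : ∀ p : ℕ, p.Prime → ∀ s ∈ S, ∀ s' ∈ S, (p : ℤ) ∣ s → (p : ℤ) ∣ s' →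
      s ≡ s' [ZMOD (p : ℤ) ^ 2]) : IsProfinitelyNull S := by
  intro δ hδ
  obtain ⟨P, hP⟩ : ∃ P : Finset Nat.Primes, -2 * Real.log δ < ∑ p ∈ P, 1 / ((p : ℕ) : ℝ) := by
    by_contra! h
    exact Nat.Primes.not_summable_one_div
      (summable_of_sum_le (fun p => by positivity) h)
  refine ⟨∏ p ∈ P, (p : ℕ) ^ 2, Finset.prod_pos fun r _ => pow_pos r.2.pos 2,
    (residueCount_prod_sq_le hS P).trans (mul_le_mul_of_nonneg_right ?_ (Nat.cast_nonneg _))⟩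
  rw [← Real.le_log_iff_exp_le hδ]
  linarith

theorem isProfinitelyNull_range_pow {k : ℕ} (hk : 2 ≤ k) :
    IsProfinitelyNull (Set.range fun n : ℕ => (n : ℤ) ^ k) := by
  refine isProfinitelyNull_of_modEq_sq fun p hp => ?_
  have h0 : ∀ n : ℕ, (p : ℤ) ∣ (n : ℤ) ^ k → (n : ℤ) ^ k ≡ 0 [ZMOD (p : ℤ) ^ 2] := fun n hn =>
    Int.modEq_zero_iff_dvd.2 <|
      (pow_dvd_pow_of_dvd ((Nat.prime_iff_prime_int.1 hp).dvd_of_dvd_pow hn) 2).trans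
        (pow_dvd_pow _ hk)
  rintro _ ⟨n, rfl⟩ _ ⟨n', rfl⟩ hn hn'
  exact (h0 n hn).trans (h0 n' hn').symm

theorem isProfinitelyNull_primes : IsProfinitelyNull {s : ℤ | ∃ p : ℕ, p.Prime ∧ s = p} := by
  refine isProfinitelyNull_of_modEq_sq fun p hp => ?_
  rintro _ ⟨r, hr, rfl⟩ _ ⟨r', hr', rfl⟩ h h'
  rw [Int.natCast_dvd_natCast, Nat.prime_dvd_prime_iff_eq hp ‹_›] at h h'
  rw [← h, ← h']

/-! ### Sparse periodic sets that contain many translates of `-S` -/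

theorem card_filter_intCast_mem_le {q : ℕ} [NeZero q] (C : Finset (ZMod q)) (n : ℕ) :
    ((Finset.Ico (0 : ℤ) n).filter fun x : ℤ => (x : ZMod q) ∈ C).card ≤ C.card * (n / q + 1) := by
  have hq : (0 : ℤ) < q := by exact_mod_cast NeZero.pos q
  have h : (C ×ˢ Finset.Icc (0 : ℤ) (n / q)).card = C.card * (n / q + 1) := by
    rw [Finset.card_product, Int.card_Icc]
    congr 1
  rw [← h]
  refine Finset.card_le_card_of_injOn (fun x : ℤ => ((x : ZMod q), x / (q : ℤ))) ?_ ?_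
  · intro x hx
    simp only [Finset.coe_filter, Finset.mem_Ico, Set.mem_ofPred_eq] at hx
    simp only [Finset.coe_product, Set.mem_prod, Finset.mem_coe, Finset.mem_Icc]
    exact ⟨hx.2, Int.ediv_nonneg hx.1.1 hq.le, Int.ediv_le_ediv hq hx.1.2.le⟩
  · intro x _ y _ hxy
    simp only [Prod.mk.injEq] at hxy
    have h1 : x % q = y % q := (ZMod.intCast_eq_intCast_iff' _ _ _).1 hxy.1
    rw [← Int.mul_ediv_add_emod x q, ← Int.mul_ediv_add_emod y q, hxy.2, h1]

/-- For a profinitely null `S` there is a set `E` containing `x + [-m, m] - S` for all `x` in some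
residue class, that avoids a prescribed interval `[0, N)` and has density at most `δ`. -/
theorem IsProfinitelyNull.exists_sparse_periodic_superset {S : Set ℤ} (hS : IsProfinitelyNull S)
    (m N : ℕ) {δ : ℝ} (hδ : 0 < δ) :
    ∃ E : Set ℤ,
      (∃ q : ℕ, 0 < q ∧ ∃ t : ℤ, ∀ x : ℤ, x ≡ t [ZMOD q] →
        ∀ i ∈ Set.Icc (-m : ℤ) m, ∀ s ∈ S, x + i - s ∈ E) ∧
      Disjoint E (Set.Ico (0 : ℤ) N) ∧
      ∃ M : ℕ, ∀ n : ℕ, M ≤ n → ((E ∩ Set.Ico (0 : ℤ) n).ncard : ℝ) ≤ δ * n := by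
  classical
  obtain ⟨q, hq, hqS⟩ := hS (min (δ / 2) (1 / (N + 1)) / (2 * m + 1)) (by positivity)
  have : NeZero q := ⟨hq.ne'⟩
  have hq' : (0 : ℝ) < q := by exact_mod_cast hq
  set R : Finset (ZMod q) := ((Int.cast : ℤ → ZMod q) '' S).toFinset with hR
  have hRcard : R.card = residueCount S q := (Set.ncard_eq_toFinset_card' _).symm
  set I : Finset (ZMod q) := (Finset.Icc (-m : ℤ) m).image Int.cast with hI
  have hIcard : I.card ≤ 2 * m + 1 := by
    refine Finset.card_image_le.trans ?_
    rw [Int.card_Icc]; omega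
  set C : Finset (ZMod q) := I - R with hC
  have hCcard : (C.card : ℝ) ≤ min (δ / 2) (1 / (N + 1)) * q := by
    have h1 : (C.card : ℝ) ≤ (2 * m + 1) * residueCount S q := by
      have h : C.card ≤ (2 * m + 1) * residueCount S q :=
        Finset.card_sub_le.trans (hRcard ▸ Nat.mul_le_mul_right _ hIcard)
      exact_mod_cast h
    refine h1.trans ((mul_le_mul_of_nonneg_left hqS (by positivity)).trans_eq ?_)
    field_simp
  -- Fewer than `q` shifts `t` are bad, i.e. make `t + C` meet the classes of `[0, N)`.
  set J : Finset (ZMod q) := (Finset.Ico (0 : ℤ) N).image Int.cast with hJ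
  obtain ⟨t, ht⟩ : ∃ t : ZMod q, t ∉ J - C := by
    by_contra! h
    have h1 : (J - C).card = q := by
      rw [Finset.eq_univ_iff_forall.2 h, Finset.card_univ, ZMod.card]
    have h2 : J.card ≤ N := by
      refine Finset.card_image_le.trans ?_
      rw [Int.card_Ico]; omega
    have h3 : (q : ℝ) ≤ N * C.card := by
      have h : (J - C).card ≤ N * C.card := Finset.card_sub_le.trans (Nat.mul_le_mul_right _ h2)
      rw [h1] at h
      exact_mod_cast h
    have h4 : (N : ℝ) * C.card ≤ N * (1 / (N + 1) * q) :=
      mul_le_mul_of_nonneg_left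
        (hCcard.trans (mul_le_mul_of_nonneg_right (min_le_right _ _) hq'.le)) (Nat.cast_nonneg _)
    have h5 : (N : ℝ) * (1 / (N + 1) * q) < q := by
      rw [← mul_assoc, mul_one_div]
      exact mul_lt_of_lt_one_left hq' ((div_lt_one (by positivity)).2 (by linarith))
    linarith
  obtain ⟨t, rfl⟩ := ZMod.intCast_surjective t
  refine ⟨{x : ℤ | ((x - t : ℤ) : ZMod q) ∈ C}, ⟨q, hq, t, ?_⟩, ?_, q, ?_⟩
  · intro x hx i hi s hs
    have hx' : (x : ZMod q) = t := (ZMod.intCast_eq_intCast_iff _ _ _).2 hx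
    refine Finset.mem_sub.2 ⟨i, Finset.mem_image_of_mem _ (Finset.mem_Icc.2 hi), s, ?_, ?_⟩
    · exact Set.mem_toFinset.2 ⟨s, hs, rfl⟩
    · push_cast
      rw [hx']
      ring
  · rw [Set.disjoint_left]
    intro x hx hxN
    refine ht (Finset.mem_sub.2 ⟨x, Finset.mem_image_of_mem _ (Finset.mem_Ico.2 hxN), _, hx, ?_⟩)
    push_cast
    ring
  · intro n hn
    set C' : Finset (ZMod q) := C.image fun c => c + (t : ZMod q)
    have h1 : {x : ℤ | ((x - t : ℤ) : ZMod q) ∈ C} ∩ Set.Ico (0 : ℤ) n ⊆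
        ((Finset.Ico (0 : ℤ) n).filter fun x : ℤ => (x : ZMod q) ∈ C' : Finset ℤ) := by
      rintro x ⟨hx, hxn⟩
      refine Finset.mem_coe.2 (Finset.mem_filter.2 ⟨Finset.mem_Ico.2 hxn, ?_⟩)
      refine Finset.mem_image.2 ⟨_, hx, ?_⟩
      push_cast
      ring
    have h2 := Set.ncard_le_ncard h1 (Finset.finite_toSet _)
    rw [Set.ncard_coe_finset] at h2
    have h3 : ({x : ℤ | ((x - t : ℤ) : ZMod q) ∈ C} ∩ Set.Ico (0 : ℤ) n).ncard ≤
        C.card * (n / q + 1) :=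
      h2.trans ((card_filter_intCast_mem_le C' n).trans
        (Nat.mul_le_mul_right _ Finset.card_image_le))
    have hn' : (q : ℝ) ≤ n := by exact_mod_cast hn
    have h4 : ((n / q : ℕ) : ℝ) + 1 ≤ 2 * (n / q) := by
      have h5 : ((n / q : ℕ) : ℝ) ≤ n / q := Nat.cast_div_le
      have h6 : (1 : ℝ) ≤ n / q := (one_le_div hq').2 hn'
      linarith
    calc (_ : ℝ) ≤ C.card * (((n / q : ℕ) : ℝ) + 1) := by exact_mod_cast h3
      _ ≤ (δ / 2 * q) * (2 * (n / q)) :=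
          mul_le_mul (hCcard.trans (mul_le_mul_of_nonneg_right (min_le_left _ _) hq'.le)) h4
            (by positivity) (by positivity)
      _ = δ * n := by field_simp

/-! ### Piecewise syndeticity and upper Banach density -/

/-- A piecewise syndetic set cannot, for every `m`, miss the intervals of radius `m` around
all points of some residue class. -/
theorem not_isPiecewiseSyndetic_of_modEq {A : Set ℤ}
    (h : ∀ m : ℕ, ∃ q : ℕ, 0 < q ∧ ∃ t : ℤ, ∀ x : ℤ, x ≡ t [ZMOD q] →
      ∀ i ∈ Set.Icc (-m : ℤ) m, x + i ∉ A) :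
    ¬ IsPiecewiseSyndetic A := by
  rintro ⟨R, T, ⟨F, hF⟩, hT, rfl⟩
  set m : ℕ := F.sup Int.natAbs with hm
  obtain ⟨q, hq, t, hqt⟩ := h m
  obtain ⟨N, hN⟩ := hT (q + 2 * m + 1)
  have hq' : (0 : ℤ) < q := by exact_mod_cast hq
  -- A point of the residue class of `t` in `[N + m, N + m + q)`.
  set x : ℤ := N + m + (t - (N + m)) % q with hx
  have hx0 := Int.emod_nonneg (t - (N + m)) hq'.ne'
  have hx1 := Int.emod_lt_of_pos (t - (N + m)) hq'
  have hxt : x ≡ t [ZMOD q] := by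
    have := (Int.mod_modEq (t - (N + m)) q).add_left (N + m)
    rwa [add_sub_cancel] at this
  obtain ⟨r, hr, f, hf, hrf⟩ : x ∈ R + (F : Set ℤ) := hF ▸ Set.mem_univ x
  have hfm : f.natAbs ≤ m := Finset.le_sup (f := Int.natAbs) hf
  simp only at hrf
  refine hqt x hxt (-f) ⟨by omega, by omega⟩ ?_
  have hxr : x + -f = r := by omega
  rw [hxr]
  refine ⟨hr, hN ⟨by omega, ?_⟩⟩
  push_cast
  omega

/-- A lower bound for the upper Banach density from arbitrarily long intervals `[0, n)`. -/
theorem le_upperBanachDensity_of_frequently {A : Set ℤ} {c : ℝ}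
    (h : ∃ᶠ n : ℕ in atTop, ((Aᶜ ∩ Set.Ico (0 : ℤ) n).ncard : ℝ) ≤ (1 - c) * n) :
    c ≤ upperBanachDensity A := by
  refine ge_of_tendsto_of_frequently (tendsto_upperBanachDensity A)
    (Filter.frequently_atTop.2 fun L => ?_)
  obtain ⟨n, hn, hcard⟩ := Filter.frequently_atTop.1 h (L + 1)
  obtain ⟨l, rfl⟩ : ∃ l, n = l + 1 := ⟨n - 1, by omega⟩
  refine ⟨l, by omega, ?_⟩
  have hIcc : ∀ N : ℤ, Set.Icc N (N + l) = Set.Ico N (N + ((l + 1 : ℕ) : ℤ)) := by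
    intro N; ext x; simp only [Set.mem_Ico, Set.mem_Icc]; push_cast; omega
  have hbdd : BddAbove (Set.range fun N : ℤ =>
      ((A ∩ Set.Icc N (N + l)).ncard : ℝ) / ((l : ℝ) + 1)) := by
    refine ⟨1, ?_⟩
    rintro _ ⟨N, rfl⟩
    have := ncard_inter_Ico_le A (l + 1) N
    rw [← hIcc, Nat.cast_add_one] at this
    exact div_le_one_of_le₀ this (by positivity)
  refine le_trans ?_ (le_ciSup hbdd 0)
  rw [le_div_iff₀ (by positivity), hIcc, zero_add]
  have hsplit : (A ∩ Set.Ico (0 : ℤ) ((l + 1 : ℕ) : ℤ)).ncard +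
      (Aᶜ ∩ Set.Ico (0 : ℤ) ((l + 1 : ℕ) : ℤ)).ncard = l + 1 := by
    have := Set.ncard_inter_add_ncard_sdiff_eq_ncard (Set.Ico (0 : ℤ) ((l + 1 : ℕ) : ℤ)) A
      (Set.finite_Ico _ _)
    rw [Set.inter_comm, Set.sdiff_eq, Set.inter_comm _ Aᶜ] at this
    rw [this, ← Finset.coe_Ico, Set.ncard_coe_finset, Int.card_Ico]
    omega
  have hsplit' : ((A ∩ Set.Ico (0 : ℤ) ((l + 1 : ℕ) : ℤ)).ncard : ℝ) +
      (Aᶜ ∩ Set.Ico (0 : ℤ) ((l + 1 : ℕ) : ℤ)).ncard = (l : ℝ) + 1 := by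
    exact_mod_cast hsplit
  rw [Nat.cast_add_one (R := ℝ)] at hcard
  linarith

/-! ### The construction -/

theorem IsProfinitelyNull.exists_not_isPiecewiseSyndetic_add {S : Set ℤ}
    (hS : IsProfinitelyNull S) {ε : ℝ} (hε : 0 < ε) :
    ∃ B : Set ℤ, upperBanachDensity B > 1 - ε ∧ ¬ IsPiecewiseSyndetic (S + B) := by
  have key := fun m N : ℕ => hS.exists_sparse_periodic_superset m N
    (δ := ε / 4 * (1 / 2) ^ m) (by positivity)
  choose E hEq hdisj M hM using key
  -- `N m` exceeds the thresholds from which `E 0, …, E (m - 1)` show their small density.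
  obtain ⟨N, hNsucc⟩ : ∃ N : ℕ → ℕ, ∀ m, N (m + 1) = N m + 1 + M m (N m) :=
    ⟨fun m => Nat.rec 0 (fun i n => n + 1 + M i n) m, fun m => rfl⟩
  have hmono : StrictMono N := strictMono_nat_of_lt_succ fun m => by rw [hNsucc]; omega
  set B : Set ℤ := (⋃ m, E m (N m))ᶜ with hB
  refine ⟨B, ?_, ?_⟩
  · refine lt_of_lt_of_le (by linarith : 1 - ε < 1 - ε / 2)
      (le_upperBanachDensity_of_frequently ?_)
    refine Filter.frequently_atTop.2 fun n => ⟨N n, hmono.le_apply, ?_⟩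
    have hsub : Bᶜ ∩ Set.Ico (0 : ℤ) (N n) ⊆
        ⋃ i ∈ Finset.range n, E i (N i) ∩ Set.Ico (0 : ℤ) ((N n : ℕ) : ℤ) := by
      rintro x ⟨hx, hxn⟩
      rw [hB, compl_compl] at hx
      obtain ⟨i, hi⟩ := Set.mem_iUnion.1 hx
      refine Set.mem_biUnion (x := i) ?_ ⟨hi, hxn⟩
      refine Finset.mem_coe.2 (Finset.mem_range.2 ?_)
      by_contra! hni
      have : (N n : ℤ) ≤ N i := by exact_mod_cast hmono.monotone hni
      exact Set.disjoint_left.1 (hdisj i (N i)) hi ⟨hxn.1, hxn.2.trans_le this⟩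
    have h1 : (Bᶜ ∩ Set.Ico (0 : ℤ) (N n)).ncard ≤
        ∑ i ∈ Finset.range n, (E i (N i) ∩ Set.Ico (0 : ℤ) (N n)).ncard :=
      (Set.ncard_le_ncard hsub ((Set.finite_Ico (0 : ℤ) (N n)).subset
        (Set.iUnion₂_subset fun i _ => Set.inter_subset_right))).trans
        (Finset.set_ncard_biUnion_le _ _)
    calc ((Bᶜ ∩ Set.Ico (0 : ℤ) (N n)).ncard : ℝ)
        ≤ ∑ i ∈ Finset.range n, ((E i (N i) ∩ Set.Ico (0 : ℤ) (N n)).ncard : ℝ) := by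
          exact_mod_cast h1
      _ ≤ ∑ i ∈ Finset.range n, ε / 4 * (1 / 2) ^ i * (N n : ℝ) := by
          refine Finset.sum_le_sum fun i hi => hM i (N i) (N n) ?_
          have := hmono.monotone (Nat.succ_le_of_lt (Finset.mem_range.1 hi))
          rw [Nat.succ_eq_add_one, hNsucc] at this
          omega
      _ = ε / 4 * (∑ i ∈ Finset.range n, (1 / 2 : ℝ) ^ i) * N n := by
          rw [← Finset.sum_mul, ← Finset.mul_sum]
      _ ≤ (1 - (1 - ε / 2)) * N n := by
          refine mul_le_mul_of_nonneg_right ?_ (Nat.cast_nonneg _)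
          have := mul_le_mul_of_nonneg_left (sum_geometric_two_le n) (by positivity : 0 ≤ ε / 4)
          linarith
  · refine not_isPiecewiseSyndetic_of_modEq fun m => ?_
    obtain ⟨q, hq, t, h⟩ := hEq m (N m)
    refine ⟨q, hq, t, fun x hx i hi => ?_⟩
    rintro ⟨s, hs, b, hb, hsb⟩
    refine hb (Set.mem_iUnion.2 ⟨m, ?_⟩)
    have := h x hx i hi s hs
    rwa [← hsb, add_sub_cancel_left] at this

theorem mainTheorem7 :
    (∀ k : ℕ, 2 ≤ k → ∀ ε : ℝ, 0 < ε →
      ∃ B : Set ℤ, upperBanachDensity B > 1 - ε ∧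
        ¬ IsPiecewiseSyndetic {x : ℤ | ∃ n : ℕ, ∃ b ∈ B, x = (n : ℤ) ^ k + b}) ∧
    (∀ ε : ℝ, 0 < ε →
      ∃ B : Set ℤ, upperBanachDensity B > 1 - ε ∧
        ¬ IsPiecewiseSyndetic {x : ℤ | ∃ p : ℕ, p.Prime ∧ ∃ b ∈ B, x = (p : ℤ) + b}) := by
  refine ⟨fun k hk ε hε => ?_, fun ε hε => ?_⟩
  · obtain ⟨B, hB, h⟩ := (isProfinitelyNull_range_pow hk).exists_not_isPiecewiseSyndetic_add hε
    refine ⟨B, hB, ?_⟩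
    convert h using 2
    ext x
    constructor
    · rintro ⟨n, b, hb, rfl⟩
      exact ⟨_, ⟨n, rfl⟩, b, hb, rfl⟩
    · rintro ⟨_, ⟨n, rfl⟩, b, hb, rfl⟩
      exact ⟨n, b, hb, rfl⟩
  · obtain ⟨B, hB, h⟩ := isProfinitelyNull_primes.exists_not_isPiecewiseSyndetic_add hε
    refine ⟨B, hB, ?_⟩
    convert h using 2
    ext x
    constructor
    · rintro ⟨p, hp, b, hb, rfl⟩
      exact ⟨_, ⟨p, hp, rfl⟩, b, hb, rfl⟩
    · rintro ⟨_, ⟨p, hp, rfl⟩, b, hb, rfl⟩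
      exact ⟨p, hp, b, hb, rfl⟩
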